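/- Let $E/F$ be a finite Galois extension of number fields with group $G$, let $K_1,K_2$ be intermediate fields, and let $G_{K_i}\subseteq G$ be the subgroup fixing $K_i$. Suppose that $K_1,K_2$ are integrally equivalent over $F$, i.e. that there is an isomorphism $\psi:\mathbb{Z}[G/G_{K_1}]\to\mathbb{Z}[G/G_{K_2}]$ of $\mathbb{Z}G$-modules, and fix any such $\psi$. Let $T_i=\mathrm{Res}_{K_i/F}(\mathbb{G}_m)$, the $F$-torus with $T_i(A)=(A\otimes_F K_i)^\times$ for every commutative $F$-algebra $A$. Its character module is $\mathbb{Z}[G/G_{K_i}]$, the coset $gG_{K_i}$ being the character induced by $a\otimes x\mapsto a\otimes g(x)$ from $A\otimes_F K_i$ to $A\otimes_F E$. Let $T_1\to T_2$ be the isomorphism of $F$-tori along which pulling back characters is $\psi^{-1}$. On $F$-points it gives an isomorphism $$\varphi: K_1^\times\to K_2^\times,$$ and for every finite place $\omega$ of $F$ it gives, on $F_\omega$-points, via the canonical isomorphisms $F_\omega\otimes_F K_i\cong\prod_{\nu\mid\omega}K_{i,\nu}$ (product over the places $\nu$ of $K_i$ above $\omega$), an isomorphism $$\varphi_\omega:\prod_{\nu\mid\omega}K_{1,\nu}^\times\to\prod_{\eta\mid\omega}K_{2,\eta}^\times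 .$$ Then: 1. for every finite place $\omega$ of $F$, $\varphi_\omega$ restricts to an isomorphism $\prod_{\nu\mid\omega}\mathcal{O}_{K_{1,\nu}}^\times\simeq\prod_{\eta\mid\omega}\mathcal{O}_{K_{2,\eta}}^\times$ (that is, it maps the first subgroup onto the second); 2. $\varphi$ restricts to an isomorphism $\mathcal{O}_{K_1}^\times\simeq\mathcal{O}_{K_2}^\times$ of unit groups. -/

import Mathlib

namespace TorusIso

open IsDedekindDomain
open scoped TensorProduct NumberField

noncomputable section

section Torus

variable {F E : Type*} [Field F] [Field E] [Algebra F E]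

/-- The `F`-embedding `K → E` given by a coset `g G_K`, where `G = Gal(E/F)` and `G_K` is the
subgroup fixing `K`: it is the restriction of `g` to `K`. -/
def cosetEmb (K : IntermediateField F E) : (E ≃ₐ[F] E) ⧸ K.fixingSubgroup → (K →ₐ[F] E) :=
  Quotient.lift (fun g : E ≃ₐ[F] E => (g : E →ₐ[F] E).comp K.val) (by
    intro g h hgh
    ext x
    have h1 : g⁻¹ * h ∈ K.fixingSubgroup := QuotientGroup.leftRel_apply.mp hgh
    have h2 := (IntermediateField.mem_fixingSubgroup_iff K _).1 h1 x x.2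
    have h3 : g ((g⁻¹ * h) (x : E)) = h x := by
      rw [← AlgEquiv.mul_apply]; simp
    rw [h2] at h3
    simpa using h3)

theorem cosetEmb_mk (K : IntermediateField F E) (g : E ≃ₐ[F] E) (x : K) :
    cosetEmb K (QuotientGroup.mk g) x = g x := rfl

variable (A : Type*) [CommRing A] [Algebra F A]

/-- The action of `g ∈ Gal(E/F)` on `A ⊗ E`, for an `F`-algebra `A`. -/
def galAct (g : E ≃ₐ[F] E) : A ⊗[F] E →ₐ[A] A ⊗[F] E :=
  Algebra.TensorProduct.map (AlgHom.id A A) (g : E →ₐ[F] E)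

/-- The character of `Res_{K/F} 𝔾ₘ` (defined over `E`) attached to a coset `c = g G_K`, as a map
`A ⊗ K → A ⊗ E`, `a ⊗ x ↦ a ⊗ g x`. -/
def character (K : IntermediateField F E) (c : (E ≃ₐ[F] E) ⧸ K.fixingSubgroup) :
    A ⊗[F] K →ₐ[A] A ⊗[F] E :=
  Algebra.TensorProduct.map (AlgHom.id A A) (cosetEmb K c)

theorem galAct_character (K : IntermediateField F E) (g : E ≃ₐ[F] E)
    (c : (E ≃ₐ[F] E) ⧸ K.fixingSubgroup) (x : A ⊗[F] K) :
    galAct A g (character A K c x) = character A K (g • c) x := by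
  induction c using QuotientGroup.induction_on with
  | H h =>
  change ((galAct A g).comp (character A K (QuotientGroup.mk h))) x =
    character A K (QuotientGroup.mk (g * h)) x
  congr 1
  ext y
  simp [galAct, character, cosetEmb_mk]

theorem character_one_injective (K : IntermediateField F E) :
    Function.Injective (character A K (QuotientGroup.mk 1)) := by
  have h := Module.Flat.lTensor_preserves_injective_linearMap (M := A)
    (cosetEmb K (QuotientGroup.mk 1)).toLinearMap (cosetEmb K (QuotientGroup.mk 1)).toRingHom.injective
  exact h

variable [FiniteDimensional F E] [IsGalois F E] [CharZero F]

theorem exists_character_one_eq (K : IntermediateField F E) (y : A ⊗[F] E)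
    (hy : ∀ g ∈ K.fixingSubgroup, galAct A g y = y) :
    ∃ x, character A K (QuotientGroup.mk 1) x = y := by
  classical
  let P : E →ₗ[F] K := (Nat.card (E ≃ₐ[K] E) : F)⁻¹ • (Algebra.trace K E).restrictScalars F
  have hn : (Nat.card (E ≃ₐ[K] E) : F) ≠ 0 := Nat.cast_ne_zero.2 Nat.card_pos.ne'
  refine ⟨P.lTensor A y, ?_⟩
  have key : ∀ z : A ⊗[F] E, character A K (QuotientGroup.mk 1) (P.lTensor A z) =
      (Nat.card (E ≃ₐ[K] E) : F)⁻¹ • ∑ σ : E ≃ₐ[K] E, galAct A (σ.restrictScalars F) z := by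
    intro z
    induction z with
    | zero => simp
    | add a b ha hb => simp only [map_add, ha, hb, Finset.sum_add_distrib, smul_add]
    | tmul a e =>
      have : ((Algebra.trace K E e : K) : E) = ∑ σ : E ≃ₐ[K] E, σ e := by
        rw [← trace_eq_sum_automorphisms]; rfl
      have h2 : cosetEmb K (QuotientGroup.mk 1) (P e) =
          (Nat.card (E ≃ₐ[K] E) : F)⁻¹ • ∑ σ : E ≃ₐ[K] E, σ e := by
        rw [cosetEmb_mk, ← this]
        rfl
      have h3 : character A K (QuotientGroup.mk 1) (P.lTensor A (a ⊗ₜ[F] e)) =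
          a ⊗ₜ[F] cosetEmb K (QuotientGroup.mk 1) (P e) := rfl
      rw [h3, h2, TensorProduct.tmul_smul, TensorProduct.tmul_sum]
      rfl
  rw [key, Finset.sum_congr rfl (g := fun _ => y)]
  · rw [Finset.sum_const, Finset.card_univ, ← Nat.card_eq_fintype_card,
      ← Nat.cast_smul_eq_nsmul F, smul_smul, inv_mul_cancel₀ hn, one_smul]
  · intro σ _
    apply hy
    rw [IntermediateField.mem_fixingSubgroup_iff]
    intro x hx
    exact σ.commutes ⟨x, hx⟩

end Torus

section Iso

variable {F E : Type*} [Field F] [Field E] [Algebra F E]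

/-- The permutation module `ℤ[G/G_K]` of `G = Gal(E/F)`, where `G_K` is the subgroup fixing `K`.
It is the character module of the torus `Res_{K/F} 𝔾ₘ`. -/
abbrev PermModule (K : IntermediateField F E) :
    Representation ℤ (E ≃ₐ[F] E) (MonoidAlgebra ℤ ((E ≃ₐ[F] E) ⧸ K.fixingSubgroup)) :=
  Representation.ofMulAction ℤ (E ≃ₐ[F] E) ((E ≃ₐ[F] E) ⧸ K.fixingSubgroup)

variable (A : Type*) [CommRing A] [Algebra F A]

/-- The group of `A`-points of the torus `Res_{K/F} 𝔾ₘ`, for an `F`-algebra `A`. -/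
abbrev TorusPoints (K : IntermediateField F E) : Type _ := (A ⊗[F] K)ˣ

/-- The value at the point `x ∈ T(A)` of the character `a ∈ ℤ[G/G_K]` of `T = Res_{K/F} 𝔾ₘ`;
the group `ℤ[G/G_K]` is written additively and the values multiplicatively. -/
def evalChar (K : IntermediateField F E) (x : TorusPoints A K)
    (a : MonoidAlgebra ℤ ((E ≃ₐ[F] E) ⧸ K.fixingSubgroup)) : (A ⊗[F] E)ˣ :=
  a.coeff.prod fun c n => Units.map (character A K c : A ⊗[F] K →* A ⊗[F] E) x ^ n

variable {A}

theorem evalChar_single (K : IntermediateField F E) (x : TorusPoints A K)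
    (c : (E ≃ₐ[F] E) ⧸ K.fixingSubgroup) (n : ℤ) :
    evalChar A K x (MonoidAlgebra.single c n) =
      Units.map (character A K c : A ⊗[F] K →* A ⊗[F] E) x ^ n := by
  simp [evalChar]

theorem evalChar_add (K : IntermediateField F E) (x : TorusPoints A K)
    (a b : MonoidAlgebra ℤ ((E ≃ₐ[F] E) ⧸ K.fixingSubgroup)) :
    evalChar A K x (a + b) = evalChar A K x a * evalChar A K x b := by
  classical
  simp only [evalChar, MonoidAlgebra.coeff_add]
  exact Finsupp.prod_add_index' (by simp) (fun c m n => zpow_add _ _ _)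

theorem evalChar_mul (K : IntermediateField F E) (x y : TorusPoints A K)
    (a : MonoidAlgebra ℤ ((E ≃ₐ[F] E) ⧸ K.fixingSubgroup)) :
    evalChar A K (x * y) a = evalChar A K x a * evalChar A K y a := by
  simp [evalChar, mul_zpow, Finsupp.prod_mul]

theorem galAct_evalChar (K : IntermediateField F E) (g : E ≃ₐ[F] E) (x : TorusPoints A K)
    (a : MonoidAlgebra ℤ ((E ≃ₐ[F] E) ⧸ K.fixingSubgroup)) :
    Units.map (galAct A g : A ⊗[F] E →* A ⊗[F] E) (evalChar A K x a) =
      evalChar A K x (PermModule K g a) := by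
  induction a using MonoidAlgebra.induction_linear with
  | zero => simp [evalChar]
  | add a b ha hb => simp only [evalChar_add, map_mul, map_add, ha, hb]
  | single c n =>
    rw [Representation.ofMulAction_single, evalChar_single, evalChar_single, map_zpow]
    congr 1
    ext
    exact galAct_character A K g c x

theorem evalChar_injective (K : IntermediateField F E) {x y : TorusPoints A K}
    (h : ∀ a, evalChar A K x a = evalChar A K y a) : x = y := by
  have := h (MonoidAlgebra.single (QuotientGroup.mk 1) 1)
  rw [evalChar_single, evalChar_single, zpow_one, zpow_one] at this
  exact Units.ext (character_one_injective A K (congrArg Units.val this))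

theorem evalChar_map {B : Type*} [CommRing B] [Algebra F B] (f : A →ₐ[F] B)
    (K : IntermediateField F E) (x : TorusPoints A K) (a) :
    evalChar B K (Units.map (Algebra.TensorProduct.map f (AlgHom.id F K) : A ⊗[F] K →* B ⊗[F] K) x) a
      = Units.map (Algebra.TensorProduct.map f (AlgHom.id F E) : A ⊗[F] E →* B ⊗[F] E)
        (evalChar A K x a) := by
  induction a using MonoidAlgebra.induction_linear with
  | zero => simp [evalChar]
  | add a b ha hb => simp only [evalChar_add, map_mul, ha, hb]
  | single c n =>
    rw [evalChar_single, evalChar_single, map_zpow]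
    congr 1
    ext
    have h : ((character B K c).restrictScalars F).comp
        (Algebra.TensorProduct.map f (AlgHom.id F K)) =
        (Algebra.TensorProduct.map f (AlgHom.id F E)).comp
          ((character A K c).restrictScalars F) := by
      ext <;> simp [character]
    exact congrArg (fun φ => φ (x : A ⊗[F] K)) h

variable [FiniteDimensional F E] [IsGalois F E] [CharZero F] {K₁ K₂ : IntermediateField F E}

theorem exists_torusHom (θ : (PermModule K₂).IntertwiningMap (PermModule K₁))
    (x : TorusPoints A K₁) :
    ∃ y : TorusPoints A K₂, ∀ a, evalChar A K₂ y a = evalChar A K₁ x (θ a) := by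
  have hfix : ∀ g ∈ K₂.fixingSubgroup, PermModule K₂ g
      (MonoidAlgebra.single (QuotientGroup.mk 1) 1) =
      MonoidAlgebra.single (QuotientGroup.mk 1) 1 := by
    intro g hg
    rw [Representation.ofMulAction_single]
    congr 1
    change QuotientGroup.mk (g * 1) = _
    rw [QuotientGroup.eq]
    simpa using hg
  have hθ : ∀ g a, θ (PermModule K₂ g a) = PermModule K₁ g (θ a) := fun g a =>
    congrArg (fun f => f a) (θ.isIntertwining' g)
  set y₀ := evalChar A K₁ x (θ (MonoidAlgebra.single (QuotientGroup.mk 1) 1)) with hy₀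
  have hy : ∀ g ∈ K₂.fixingSubgroup, Units.map (galAct A g : A ⊗[F] E →* A ⊗[F] E) y₀ = y₀ := by
    intro g hg
    rw [hy₀, galAct_evalChar, ← hθ, hfix g hg]
  obtain ⟨u, hu⟩ := exists_character_one_eq A K₂ (y₀ : A ⊗[F] E)
    (fun g hg => congrArg Units.val (hy g hg))
  obtain ⟨v, hv⟩ := exists_character_one_eq A K₂ ((y₀⁻¹ : (A ⊗[F] E)ˣ) : A ⊗[F] E)
    (fun g hg => by
      have := congrArg (fun z : (A ⊗[F] E)ˣ => ((z⁻¹ : (A ⊗[F] E)ˣ) : A ⊗[F] E)) (hy g hg)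
      rwa [← map_inv] at this)
  have huv : u * v = 1 := by
    apply character_one_injective A K₂
    exact ((map_mul _ _ _).trans (by rw [hu, hv, Units.mul_inv])).trans (RingHom.map_one (character A K₂ (QuotientGroup.mk 1)).toRingHom).symm
  let y : TorusPoints A K₂ := ⟨u, v, huv, (mul_comm v u).trans huv⟩
  have hy1 : Units.map (character A K₂ (QuotientGroup.mk 1) : A ⊗[F] K₂ →* A ⊗[F] E) y = y₀ :=
    Units.ext hu
  refine ⟨y, fun a => ?_⟩
  induction a using MonoidAlgebra.induction_linear with
  | zero => simp [evalChar]
  | add a b ha hb => simp only [evalChar_add, map_add, ha, hb]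
  | single c n =>
    induction c using QuotientGroup.induction_on with
    | H g =>
    have h1 : (MonoidAlgebra.single (QuotientGroup.mk g) n :
        MonoidAlgebra ℤ ((E ≃ₐ[F] E) ⧸ K₂.fixingSubgroup)) =
        n • PermModule K₂ g (MonoidAlgebra.single (QuotientGroup.mk 1) 1) := by
      rw [Representation.ofMulAction_single, MonoidAlgebra.smul_single]
      change _ = MonoidAlgebra.single (QuotientGroup.mk (g * 1)) _
      simp
    have h2 : ∀ (K : IntermediateField F E) (x : TorusPoints A K) (n : ℤ) a,
        evalChar A K x (n • a) = evalChar A K x a ^ n := by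
      intro K x n a
      let f : MonoidAlgebra ℤ ((E ≃ₐ[F] E) ⧸ K.fixingSubgroup) →+ Additive (A ⊗[F] E)ˣ :=
        AddMonoidHom.mk' (fun a => Additive.ofMul (evalChar A K x a))
          (fun a b => by simp [evalChar_add])
      exact map_zsmul f n a
    rw [h1, map_zsmul, h2, h2, hθ, ← galAct_evalChar, ← galAct_evalChar, ← hy₀, evalChar_single,
      zpow_one, hy1]

variable (A)

/-- The morphism of tori `Res_{K₁/F} 𝔾ₘ → Res_{K₂/F} 𝔾ₘ`, on `A`-points, attached to a morphism
`θ : ℤ[G/G_{K₂}] → ℤ[G/G_{K₁}]` of `G`-modules: pulling back characters along it is `θ`. -/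
def torusHom (θ : (PermModule K₂).IntertwiningMap (PermModule K₁)) :
    TorusPoints A K₁ →* TorusPoints A K₂ :=
  MonoidHom.mk' (fun x => (exists_torusHom θ x).choose) fun x y =>
    evalChar_injective K₂ fun a => by
      rw [evalChar_mul, (exists_torusHom θ x).choose_spec, (exists_torusHom θ y).choose_spec,
        (exists_torusHom θ (x * y)).choose_spec, evalChar_mul]

theorem evalChar_torusHom (θ : (PermModule K₂).IntertwiningMap (PermModule K₁))
    (x : TorusPoints A K₁) (a) :
    evalChar A K₂ (torusHom A θ x) a = evalChar A K₁ x (θ a) :=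
  (exists_torusHom θ x).choose_spec a

/-- The isomorphism of tori `Res_{K₁/F} 𝔾ₘ ≃ Res_{K₂/F} 𝔾ₘ`, on `A`-points, attached to an
isomorphism `ψ : ℤ[G/G_{K₁}] ≃ ℤ[G/G_{K₂}]` of `G`-modules. -/
def torusIso (ψ : (PermModule K₁).Equiv (PermModule K₂)) :
    TorusPoints A K₁ ≃* TorusPoints A K₂ where
  __ := torusHom A ψ.symm.toIntertwiningMap
  invFun := torusHom A ψ.toIntertwiningMap
  left_inv x := evalChar_injective K₁ fun a => by
    change evalChar A K₁ (torusHom A ψ.toIntertwiningMap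
      (torusHom A ψ.symm.toIntertwiningMap x)) a = _
    rw [evalChar_torusHom, evalChar_torusHom]
    exact congrArg _ (ψ.toLinearEquiv.symm_apply_apply a)
  right_inv x := evalChar_injective K₂ fun a => by
    change evalChar A K₂ (torusHom A ψ.symm.toIntertwiningMap
      (torusHom A ψ.toIntertwiningMap x)) a = _
    rw [evalChar_torusHom, evalChar_torusHom]
    exact congrArg _ (ψ.toLinearEquiv.apply_symm_apply a)

/-- On characters, the isomorphism of tori attached to `ψ` is `ψ⁻¹`. -/
theorem evalChar_torusIso (ψ : (PermModule K₁).Equiv (PermModule K₂))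
    (x : TorusPoints A K₁) (a) :
    evalChar A K₂ (torusIso A ψ x) a = evalChar A K₁ x (ψ.symm a) :=
  evalChar_torusHom A ψ.symm.toIntertwiningMap x a

/-- The isomorphism `torusIso` is natural in the `F`-algebra `A`. -/
theorem torusIso_map {B : Type*} [CommRing B] [Algebra F B] (f : A →ₐ[F] B)
    (ψ : (PermModule K₁).Equiv (PermModule K₂)) (x : TorusPoints A K₁) :
    torusIso B ψ
        (Units.map (Algebra.TensorProduct.map f (AlgHom.id F K₁) : A ⊗[F] K₁ →* B ⊗[F] K₁) x) =
      Units.map (Algebra.TensorProduct.map f (AlgHom.id F K₂) : A ⊗[F] K₂ →* B ⊗[F] K₂)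
        (torusIso A ψ x) :=
  evalChar_injective K₂ fun a => by
    rw [evalChar_torusIso, evalChar_map, evalChar_map, evalChar_torusIso]

/-- The isomorphism `K₁ˣ ≃ K₂ˣ` that the isomorphism of tori induces on `F`-points. -/
def globalIso (ψ : (PermModule K₁).Equiv (PermModule K₂)) : K₁ˣ ≃* K₂ˣ :=
  ((Units.mapEquiv (Algebra.TensorProduct.lid F K₁).toMulEquiv).symm.trans
    (torusIso F ψ)).trans (Units.mapEquiv (Algebra.TensorProduct.lid F K₂).toMulEquiv)

end Iso

section Local
variable {F : Type*} [Field F] [NumberField F] (K : Type*) [Field K] [NumberField K] [Algebra F K]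

/-- The finite places of `K` dividing the finite place `ω` of `F`. -/
abbrev PlacesOver (ω : HeightOneSpectrum (𝓞 F)) : Type _ :=
  {ν : HeightOneSpectrum (𝓞 K) // ν.asIdeal.LiesOver ω.asIdeal}

variable {K}

theorem continuous_toAdicCompletion (ω : HeightOneSpectrum (𝓞 F)) (ν : PlacesOver K ω) :
    Continuous (algebraMap (WithVal (ω.valuation F)) (WithVal (ν.1.valuation K))) :=
  haveI := ν.2
  (HeightOneSpectrum.uniformContinuous_algebraMap_liesOver F K ω ν.1).continuous

/-- The continuous extension `F_ω → K_ν` of `F → K`, for `ν` dividing `ω`. -/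
def adicCompletionMap (ω : HeightOneSpectrum (𝓞 F)) (ν : PlacesOver K ω) :
    ω.adicCompletion F →+* ν.1.adicCompletion K :=
  ((HeightOneSpectrum.adicCompletion.equiv K ν.1).symm.toRingHom.comp
    (UniformSpace.Completion.mapRingHom
      (algebraMap (WithVal (ω.valuation F)) (WithVal (ν.1.valuation K)))
      (continuous_toAdicCompletion ω ν))).comp
    (HeightOneSpectrum.adicCompletion.equiv F ω).toRingHom

theorem continuous_adicCompletionMap (ω : HeightOneSpectrum (𝓞 F)) (ν : PlacesOver K ω) :
    Continuous (adicCompletionMap ω ν) :=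
  (HeightOneSpectrum.adicCompletion.continuous_ofCompletion K ν.1).comp <|
    UniformSpace.Completion.continuous_map.comp
      (HeightOneSpectrum.adicCompletion.continuous_toCompletion F ω)

theorem adicCompletionMap_algebraMap (ω : HeightOneSpectrum (𝓞 F)) (ν : PlacesOver K ω) (x : F) :
    adicCompletionMap ω ν (algebraMap F _ x) = algebraMap F _ x := by
  rw [IsScalarTower.algebraMap_apply F K (ν.1.adicCompletion K)]
  apply HeightOneSpectrum.adicCompletion.ext
  exact UniformSpace.Completion.mapRingHom_coe (continuous_toAdicCompletion ω ν) _

theorem valued_algebraMap {v : HeightOneSpectrum (𝓞 K)} (x : K) :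
    Valued.v (algebraMap K (v.adicCompletion K) x) = v.valuation K x :=
  HeightOneSpectrum.adicCompletion.valued_coe K v x

theorem valuation_algebraMap (ω : HeightOneSpectrum (𝓞 F)) (ν : PlacesOver K ω) (x : F) :
    ω.valuation F x ≤ 1 → ν.1.valuation K (algebraMap F K x) ≤ 1 := by
  have := ν.2
  intro h
  rw [← HeightOneSpectrum.valuation_liesOver K ω ν.1]
  exact pow_le_one' h _

theorem adicCompletionMap_integers (ω : HeightOneSpectrum (𝓞 F)) (ν : PlacesOver K ω)
    (x : ω.adicCompletion F) (hx : Valued.v x ≤ 1) : Valued.v (adicCompletionMap ω ν x) ≤ 1 := by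
  have h1 : IsOpen {x : ω.adicCompletion F | Valued.v x ≤ 1} :=
    Valued.isOpen_integer (ω.adicCompletion F)
  have h2 : IsClosed {x : ν.1.adicCompletion K | Valued.v x ≤ 1} :=
    Valued.isClosed_integer (ν.1.adicCompletion K)
  have h3 := (ω.denseRange_algebraMap F).open_subset_closure_inter h1 hx
  refine closure_minimal (t := (adicCompletionMap ω ν) ⁻¹' {x | Valued.v x ≤ 1}) ?_
    (h2.preimage (continuous_adicCompletionMap ω ν)) h3
  rintro _ ⟨hy, y, rfl⟩
  rw [Set.mem_preimage, adicCompletionMap_algebraMap,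
    IsScalarTower.algebraMap_apply F K (ν.1.adicCompletion K), Set.mem_ofPred_eq, valued_algebraMap]
  exact valuation_algebraMap ω ν y (by simpa [valued_algebraMap] using hy)

instance finite_placesOver (ω : HeightOneSpectrum (𝓞 F)) : Finite (PlacesOver K ω) := by
  have h : (ω.asIdeal.primesOver (𝓞 K)).Finite := Algebra.QuasiFinite.finite_primesOver _
  have := h.to_subtype
  exact Finite.of_injective
    (fun ν : PlacesOver K ω => (⟨ν.1.asIdeal, ν.1.isPrime, ν.2⟩ : ω.asIdeal.primesOver (𝓞 K)))
    fun a b h => Subtype.ext (HeightOneSpectrum.ext (congrArg Subtype.val h))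

variable (K) in
/-- The canonical map `F_ω ⊗ K → ∏_{ν ∣ ω} K_ν`. -/
def completionTensorMap (ω : HeightOneSpectrum (𝓞 F)) :
    ω.adicCompletion F ⊗[F] K →ₐ[F] Π ν : PlacesOver K ω, ν.1.adicCompletion K :=
  AlgHom.pi fun ν => Algebra.TensorProduct.productMap
    { adicCompletionMap ω ν with commutes' := adicCompletionMap_algebraMap ω ν }
    (IsScalarTower.toAlgHom F K (ν.1.adicCompletion K))

theorem completionTensorMap_tmul (ω : HeightOneSpectrum (𝓞 F)) (a : ω.adicCompletion F) (x : K)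
    (ν : PlacesOver K ω) : completionTensorMap K ω (a ⊗ₜ x) ν =
      adicCompletionMap ω ν a * algebraMap K _ x := rfl

open NumberField in
theorem denseRange_pi (ω : HeightOneSpectrum (𝓞 F)) :
    DenseRange fun (x : K) (ν : PlacesOver K ω) => algebraMap K (ν.1.adicCompletion K) x := by
  have h := AbsoluteValue.denseRange_algebraMap_pi
    (v := fun ν : PlacesOver K ω => HeightOneSpectrum.adicAbv K ν.1) ?_ ?_
  · let f : ∀ ν : PlacesOver K ω, WithAbs (HeightOneSpectrum.adicAbv K ν.1) →
        ν.1.adicCompletion K := fun ν x => algebraMap K _ (WithAbs.equiv _ x)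
    have hf : ∀ ν, Continuous (f ν) := fun ν => by
      refine AddMonoidHomClass.continuous_of_bound
        ((algebraMap K (ν.1.adicCompletion K)).comp (WithAbs.equiv _).toRingHom) 1 fun x => ?_
      rw [one_mul]
      exact (FinitePlace.norm_embedding ν.1 _).le
    have hd : DenseRange (Pi.map f) := DenseRange.piMap fun ν => by
      refine (ν.1.denseRange_algebraMap K).mono ?_
      rintro _ ⟨x, rfl⟩
      exact ⟨(WithAbs.equiv _).symm x, rfl⟩
    exact hd.comp h (Continuous.piMap hf)
  · intro ν
    obtain ⟨x, hx, h0⟩ := Submodule.exists_mem_ne_zero_of_ne_bot ν.1.ne_bot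
    refine ⟨algebraMap _ K x, by simpa using h0, ?_⟩
    rw [← FinitePlace.norm_embedding]
    exact ((FinitePlace.norm_lt_one_iff_mem K ν.1 x).2 hx).ne
  · intro ν₁ ν₂ hne heq
    apply hne
    have hle : ν₁.1.asIdeal ≤ ν₂.1.asIdeal := by
      intro x hx
      rw [← FinitePlace.norm_lt_one_iff_mem K, FinitePlace.norm_embedding] at hx ⊢
      exact (heq.lt_one_iff).1 hx
    exact Subtype.ext (HeightOneSpectrum.ext
      (ν₁.1.isMaximal.eq_of_le ν₂.1.isPrime.ne_top hle))

theorem completionTensorMap_surjective (ω : HeightOneSpectrum (𝓞 F)) :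
    Function.Surjective (completionTensorMap K ω) := by
  let (ν : PlacesOver K ω) : Algebra (ω.adicCompletion F) (ν.1.adicCompletion K) :=
    (adicCompletionMap ω ν).toAlgebra
  have (ν : PlacesOver K ω) :
      ContinuousSMul (ω.adicCompletion F) (ν.1.adicCompletion K) :=
    ⟨((continuous_adicCompletionMap ω ν).comp continuous_fst).mul continuous_snd⟩
  open scoped Valued in
  let Φ : ω.adicCompletion F ⊗[F] K →ₗ[ω.adicCompletion F]
      Π ν : PlacesOver K ω, ν.1.adicCompletion K :=
    { completionTensorMap K ω with
      map_smul' := fun c x => by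
        induction x with
        | zero => simp
        | add a b ha hb =>
          simp only [smul_add, map_add, AlgHom.toRingHom_eq_coe, RingHom.toMonoidHom_eq_coe,
            OneHom.toFun_eq_coe, MonoidHom.toOneHom_coe, MonoidHom.coe_coe, RingHom.coe_coe,
            RingHom.id_apply] at ha hb ⊢
          rw [ha, hb]
        | tmul a x =>
          funext ν
          change adicCompletionMap ω ν (c * a) * _ = adicCompletionMap ω ν c * (_ * _)
          rw [map_mul, mul_assoc]
          rfl }
  have hd : DenseRange Φ := by
    refine (denseRange_pi (K := K) ω).mono ?_
    rintro _ ⟨x, rfl⟩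
    refine ⟨1 ⊗ₜ x, funext fun ν => ?_⟩
    change adicCompletionMap ω ν 1 * _ = _
    rw [map_one, one_mul]
    rfl
  have : Function.Surjective Φ := by
    rw [← Set.range_eq_univ, ← Φ.coe_range, ← Φ.range.closed_of_finiteDimensional.closure_eq]
    exact hd.closure_range
  exact this

theorem exists_mul_mem_integers (ω : HeightOneSpectrum (𝓞 F)) (y : K)
    (hy : ∀ ν : PlacesOver K ω, ν.1.valuation K y ≤ 1) :
    ∃ s : 𝓞 F, s ∉ ω.asIdeal ∧ ∃ z : 𝓞 K, algebraMap (𝓞 K) K z = algebraMap (𝓞 F) K s * y := by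
  classical
  have hfin := HeightOneSpectrum.Support.finite (𝓞 K) y
  have h1 : ∀ v ∈ HeightOneSpectrum.Support (𝓞 K) y, ∃ t : 𝓞 F, t ∉ ω.asIdeal ∧
      v.valuation K (algebraMap (𝓞 F) K t * y) ≤ 1 := by
    intro v hv
    have hnot : ¬ v.asIdeal.LiesOver ω.asIdeal := fun h => absurd (hy ⟨v, h⟩) (not_le.2 hv)
    have hle : ¬ v.asIdeal.under (𝓞 F) ≤ ω.asIdeal := by
      intro hle
      have hmax : (v.asIdeal.under (𝓞 F)).IsMaximal := by
        have := v.isMaximal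
        exact Ideal.isMaximal_comap_of_isIntegral_of_isMaximal v.asIdeal
      exact hnot ⟨(hmax.eq_of_le ω.isPrime.ne_top hle).symm⟩
    obtain ⟨t, ht, htω⟩ := SetLike.not_le_iff_exists.1 hle
    have htv : v.valuation K (algebraMap (𝓞 F) K t) < 1 := by
      rw [IsScalarTower.algebraMap_apply (𝓞 F) (𝓞 K) K]
      exact (v.valuation_lt_one_iff_mem _).2 ht
    have ht0 : v.valuation K (algebraMap (𝓞 F) K t) ≠ 0 := by
      rw [Valuation.ne_zero_iff, IsScalarTower.algebraMap_apply (𝓞 F) F K, map_ne_zero,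
        ne_eq, FaithfulSMul.algebraMap_eq_zero_iff]
      rintro rfl
      exact htω (zero_mem _)
    obtain ⟨n, hn⟩ := MulArchimedean.arch (v.valuation K y)
      (one_lt_inv₀ (zero_lt_iff.2 ht0) |>.2 htv)
    refine ⟨t ^ n, fun h => htω (ω.isPrime.mem_of_pow_mem n h), ?_⟩
    rw [map_pow, map_mul, map_pow]
    calc _ ≤ v.valuation K (algebraMap (𝓞 F) K t) ^ n *
          (v.valuation K (algebraMap (𝓞 F) K t))⁻¹ ^ n := by gcongr
      _ = 1 := by rw [← mul_pow, mul_inv_cancel₀ ht0, one_pow]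
  choose! t ht ht' using h1
  refine ⟨∏ v ∈ hfin.toFinset, t v, fun h => ?_, ?_⟩
  · obtain ⟨v, hv, hv'⟩ := (Ideal.IsPrime.prod_mem_iff (hp := ω.isPrime)).1 h
    exact ht v (hfin.mem_toFinset.1 hv) hv'
  · obtain ⟨z, hz⟩ := HeightOneSpectrum.mem_integers_of_valuation_le_one (R := 𝓞 K) K
      (algebraMap (𝓞 F) K (∏ v ∈ hfin.toFinset, t v) * y) fun v => by
        have hint : ∀ r : 𝓞 F, v.valuation K (algebraMap (𝓞 F) K r) ≤ 1 := fun r => by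
          rw [IsScalarTower.algebraMap_apply (𝓞 F) (𝓞 K) K]
          exact v.valuation_le_one _
        by_cases hv : v ∈ HeightOneSpectrum.Support (𝓞 K) y
        · rw [← Finset.mul_prod_erase _ _ (hfin.mem_toFinset.2 hv), map_mul (algebraMap (𝓞 F) K),
            mul_right_comm, map_mul]
          exact mul_le_one' (ht' v hv) (hint _)
        · rw [map_mul]
          exact mul_le_one' (hint _) (not_lt.1 hv)
    exact ⟨z, hz⟩

theorem exists_coord_denominator {ι : Type*} [Finite ι] (b : Module.Basis ι F K) :
    ∃ D : 𝓞 F, D ≠ 0 ∧ ∀ (z : 𝓞 K) (i : ι), ∃ r : 𝓞 F,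
      algebraMap (𝓞 F) F r = algebraMap (𝓞 F) F D * b.repr (algebraMap (𝓞 K) K z) i := by
  classical
  have := Fintype.ofFinite ι
  obtain ⟨S, hS⟩ := (Module.Finite.fg_top : (⊤ : Submodule (𝓞 F) (𝓞 K)).FG)
  obtain ⟨D, hD⟩ := IsLocalization.exist_integer_multiples_of_finset (nonZeroDivisors (𝓞 F))
    ((S ×ˢ (Finset.univ : Finset ι)).image fun p => b.repr (algebraMap (𝓞 K) K p.1) p.2)
  refine ⟨D, nonZeroDivisors.ne_zero D.2, fun z i => ?_⟩
  have hz : z ∈ Submodule.span (𝓞 F) (S : Set (𝓞 K)) := hS ▸ Submodule.mem_top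
  induction hz using Submodule.span_induction with
  | mem x hx =>
    obtain ⟨r, hr⟩ := hD (b.repr (algebraMap (𝓞 K) K x) i)
      (Finset.mem_image.2 ⟨(x, i), by simpa using hx, rfl⟩)
    exact ⟨r, by rw [hr, Algebra.smul_def]⟩
  | zero => exact ⟨0, by simp⟩
  | add x y _ _ hx hy =>
    obtain ⟨r, hr⟩ := hx
    obtain ⟨r', hr'⟩ := hy
    exact ⟨r + r', by simp [hr, hr', mul_add]⟩
  | smul a x _ hx =>
    obtain ⟨r, hr⟩ := hx
    refine ⟨a * r, ?_⟩
    have : algebraMap (𝓞 K) K (a • x) = algebraMap (𝓞 F) F a • algebraMap (𝓞 K) K x := by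
      rw [Algebra.smul_def, map_mul, ← IsScalarTower.algebraMap_apply, Algebra.smul_def,
        ← IsScalarTower.algebraMap_apply]
    rw [this, map_mul, hr, map_smul, Finsupp.smul_apply, smul_eq_mul, mul_left_comm]

theorem completionTensorMap_injective (ω : HeightOneSpectrum (𝓞 F)) :
    Function.Injective (completionTensorMap K ω) := by
  classical
  obtain ⟨s, b, hb'⟩ := FiniteDimensional.exists_is_basis_integral (𝓞 F) F K
  have hb : ∀ i, IsIntegral ℤ (b i) := fun i => isIntegral_trans (b i) (hb' i)
  obtain ⟨D, hD0, hD⟩ := exists_coord_denominator b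
  have hbν : ∀ (ν : PlacesOver K ω) i, Valued.v (algebraMap K (ν.1.adicCompletion K) (b i)) ≤ 1 := by
    intro ν i
    rw [valued_algebraMap]
    exact ν.1.valuation_le_one (⟨b i, hb i⟩ : 𝓞 K)
  have hcoord : ∀ y : K, (∀ ν : PlacesOver K ω, ν.1.valuation K y ≤ 1) → ∀ i,
      ω.valuation F (algebraMap (𝓞 F) F D * b.repr y i) ≤ 1 := by
    intro y hy i
    obtain ⟨t, ht, z, hz⟩ := exists_mul_mem_integers ω y hy
    obtain ⟨r, hr⟩ := hD z i
    have hz' : algebraMap (𝓞 K) K z = algebraMap (𝓞 F) F t • y := by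
      rw [hz, Algebra.smul_def, ← IsScalarTower.algebraMap_apply]
    rw [hz', map_smul, Finsupp.smul_apply, smul_eq_mul, mul_left_comm] at hr
    have h1 := congrArg (ω.valuation F) hr
    rw [map_mul, ω.valuation_eq_one_iff_notMem.2 ht, one_mul] at h1
    rw [← h1]
    exact ω.valuation_le_one r
  let B := Algebra.TensorProduct.basis (ω.adicCompletion F) b
  have hbound : ∀ x, completionTensorMap K ω x = 0 → ∀ i,
      Valued.v (algebraMap F (ω.adicCompletion F) (algebraMap (𝓞 F) F D) * B.repr x i) ≤ 1 := by
    intro x hx i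
    have happrox : ∀ j, ∃ α : F,
        Valued.v (B.repr x j - algebraMap F (ω.adicCompletion F) α) ≤ 1 := by
      intro j
      have h1 : IsOpen {c : ω.adicCompletion F | Valued.v c ≤ 1} :=
        Valued.isOpen_integer (ω.adicCompletion F)
      have h2 : IsOpen {c : ω.adicCompletion F | Valued.v (B.repr x j - c) ≤ 1} :=
        h1.preimage (continuous_const.sub continuous_id)
      obtain ⟨_, h3, α, rfl⟩ := (ω.denseRange_algebraMap F).inter_open_nonempty _ h2
        ⟨B.repr x j, by simp⟩
      exact ⟨α, h3⟩
    choose α hα using happrox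
    have hx' : x = ∑ j, B.repr x j ⊗ₜ[F] b j := by
      conv_lhs => rw [← B.sum_repr x]
      refine Finset.sum_congr rfl fun j _ => ?_
      rw [Algebra.TensorProduct.basis_apply, TensorProduct.smul_tmul', smul_eq_mul, mul_one]
    have hy : ∀ ν : PlacesOver K ω, ν.1.valuation K (∑ j, α j • b j) ≤ 1 := by
      intro ν
      have h0 : ∑ j, adicCompletionMap ω ν (B.repr x j) * algebraMap K (ν.1.adicCompletion K) (b j)
          = 0 := by
        have := congrFun hx ν
        rw [hx', map_sum, Finset.sum_apply] at this
        exact this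
      have h1 : algebraMap K (ν.1.adicCompletion K) (∑ j, α j • b j) =
          - ∑ j, adicCompletionMap ω ν (B.repr x j - algebraMap F _ (α j)) *
            algebraMap K (ν.1.adicCompletion K) (b j) := by
        simp only [map_sub, sub_mul, Finset.sum_sub_distrib, h0, adicCompletionMap_algebraMap,
          map_sum, zero_sub, neg_neg, Algebra.smul_def, map_mul,
          ← IsScalarTower.algebraMap_apply]
      rw [← valued_algebraMap, h1, Valuation.map_neg]
      refine Valuation.map_sum_le _ fun j _ => ?_
      rw [map_mul]
      exact mul_le_one' (adicCompletionMap_integers ω ν _ (hα j)) (hbν ν j)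
    have h2 := hcoord _ hy i
    rw [b.repr_sum_self] at h2
    have h3 : algebraMap F (ω.adicCompletion F) (algebraMap (𝓞 F) F D) * B.repr x i =
        algebraMap F (ω.adicCompletion F) (algebraMap (𝓞 F) F D) *
          (B.repr x i - algebraMap F _ (α i)) +
        algebraMap F (ω.adicCompletion F) (algebraMap (𝓞 F) F D * α i) := by
      rw [map_mul]; ring
    rw [h3]
    refine Valuation.map_add_le _ ?_ ?_
    · rw [map_mul, valued_algebraMap]
      exact mul_le_one' (ω.valuation_le_one D) (hα i)
    · rw [valued_algebraMap]
      exact h2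
  rw [injective_iff_map_eq_zero]
  intro x hx
  refine B.repr.map_eq_zero_iff.1 (Finsupp.ext fun i => ?_)
  by_contra hne
  set d := algebraMap F (ω.adicCompletion F) (algebraMap (𝓞 F) F D) * B.repr x i with hd
  have hd0 : d ≠ 0 := mul_ne_zero (by simpa using hD0) hne
  obtain ⟨π, hπ⟩ := ω.valuation_exists_uniformizer F
  have h1 := hbound ((algebraMap F (ω.adicCompletion F) π * d)⁻¹ • x) (by
    rw [Algebra.smul_def, map_mul, hx, mul_zero]) i
  rw [map_smul, Finsupp.smul_apply, smul_eq_mul, mul_left_comm, ← hd, mul_inv, mul_assoc,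
    inv_mul_cancel₀ hd0, mul_one, map_inv₀, valued_algebraMap, hπ] at h1
  exact absurd h1 (by simp [← WithZero.exp_neg, ← WithZero.exp_zero])

variable (K) in
/-- The canonical isomorphism `F_ω ⊗ K ≃ ∏_{ν ∣ ω} K_ν`. -/
def completionTensorEquiv (ω : HeightOneSpectrum (𝓞 F)) :
    ω.adicCompletion F ⊗[F] K ≃ₐ[F] Π ν : PlacesOver K ω, ν.1.adicCompletion K :=
  AlgEquiv.ofBijective (completionTensorMap K ω)
    ⟨completionTensorMap_injective ω, completionTensorMap_surjective ω⟩

variable (K) in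
/-- The subgroup `∏_{ν ∣ ω} 𝓞_νˣ` of `∏_{ν ∣ ω} K_νˣ`. -/
def localUnits (ω : HeightOneSpectrum (𝓞 F)) :
    Subgroup (Π ν : PlacesOver K ω, (ν.1.adicCompletion K)ˣ) :=
  Subgroup.pi Set.univ fun ν => (ν.1.adicCompletionIntegers K).unitGroup

variable (K) in
/-- The unit group `𝓞_Kˣ` as a subgroup of `Kˣ`. -/
def globalUnits : Subgroup Kˣ :=
  (Units.map (algebraMap (𝓞 K) K : 𝓞 K →* K)).range

end Local

section LocalIso

variable {F E : Type*} [Field F] [NumberField F] [Field E] [NumberField E] [Algebra F E]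

/-- The identification `T(F_ω) = ∏_{ν ∣ ω} K_νˣ` for `T = Res_{K/F} 𝔾ₘ`. -/
def localPoints (K : IntermediateField F E) (ω : HeightOneSpectrum (𝓞 F)) :
    TorusPoints (ω.adicCompletion F) K ≃* Π ν : PlacesOver K ω, (ν.1.adicCompletion K)ˣ :=
  (Units.mapEquiv (completionTensorEquiv K ω).toMulEquiv).trans MulEquiv.piUnits

/-- The isomorphism `φ_ω : ∏_{ν ∣ ω} K_{1,ν}ˣ ≃ ∏_{η ∣ ω} K_{2,η}ˣ` that the isomorphism of tori
induces on `F_ω`-points. -/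
def localIso [IsGalois F E] {K₁ K₂ : IntermediateField F E}
    (ψ : (PermModule K₁).Equiv (PermModule K₂)) (ω : HeightOneSpectrum (𝓞 F)) :
    (Π ν : PlacesOver K₁ ω, (ν.1.adicCompletion K₁)ˣ) ≃*
      Π η : PlacesOver K₂ ω, (η.1.adicCompletion K₂)ˣ :=
  ((localPoints K₁ ω).symm.trans (torusIso (ω.adicCompletion F) ψ)).trans (localPoints K₂ ω)

end LocalIso

end

end TorusIso

namespace TorusIso

open IsDedekindDomain NumberField
open scoped TensorProduct NumberField

noncomputable section

/-! ### Integral units of an algebra -/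

section IntegralUnits

variable {R B C : Type*} [CommRing R] [CommRing B] [CommRing C]

/-! Both claims are instances of one fact: an isomorphism of tori coming from an isomorphism of
character lattices preserves the points that are integral together with their inverses. Let `R → A`
be a ring map into an `F`-algebra and call a point of `(A ⊗ K)ˣ` integral if it and its inverse are
integral over `R`. Every character of the torus comes from `A`-algebra maps `A ⊗ K → A ⊗ E` by
taking products of integer powers, so it carries integral points to integral units of `A ⊗ E`.
Conversely, the character of the trivial coset is injective, so it detects integral points. Its
value at the image of `x` under the torus map is the value at `x` of another character, hence an
integral unit whenever `x` is integral (`torusHom_mem_integralPoints`). Applying this to `ψ` and to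
`ψ⁻¹` gives an equivalence (`torusIso_mem_integralPoints_iff`).

It remains to recognise the integral points. For `ℤ → F` they are the units of the ring of integers,
directly from the definition, so the global claim needs no local input. For the integers of `F_ω`
inside `F_ω` they are the products of local unit groups, because the integral closure of the
integers in `F_ω ⊗ K ≅ ∏ K_ν` is `∏ 𝓞_ν` (`isIntegralElem_iff_valued_le_one`). One inclusion holds
since each `𝓞_ν` is integrally closed. For the other, an element with integral components is split,
by density of `F` in `F_ω`, into a combination of integral basis vectors with coefficients in the
integers of `F_ω`, plus an element of `K` that is integral at every `ν ∣ ω`. The latter becomes an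
algebraic integer after multiplication by some `s ∈ 𝓞 F` that is a unit at `ω`. -/

/-- The group of units `x` of `B` such that both `x` and `x⁻¹` are integral over `R`. -/
def integralUnits (f : R →+* B) : Subgroup Bˣ where
  carrier := {x | f.IsIntegralElem x ∧ f.IsIntegralElem (x⁻¹ : Bˣ)}
  one_mem' := ⟨f.isIntegralElem_one, by simpa using f.isIntegralElem_one⟩
  mul_mem' := fun {x y} hx hy => ⟨by simpa using hx.1.mul f hy.1,
    by simpa [mul_comm] using hx.2.mul f hy.2⟩
  inv_mem' := fun {x} hx => ⟨hx.2, by simpa using hx.1⟩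

theorem mem_integralUnits {f : R →+* B} {x : Bˣ} :
    x ∈ integralUnits f ↔ f.IsIntegralElem x ∧ f.IsIntegralElem (x⁻¹ : Bˣ) := Iff.rfl

theorem map_mem_integralUnits {f : R →+* B} (g : B →+* C) {x : Bˣ} (hx : x ∈ integralUnits f) :
    Units.map (g : B →* C) x ∈ integralUnits (g.comp f) :=
  ⟨hx.1.map g, hx.2.map g⟩

/-- Under an injective map, a monic equation satisfied by the image already holds upstairs, so
integrality is reflected as well as preserved. -/
theorem map_mem_integralUnits_iff {f : R →+* B} {g : B →+* C} (hg : Function.Injective g)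
    {x : Bˣ} : Units.map (g : B →* C) x ∈ integralUnits (g.comp f) ↔ x ∈ integralUnits f :=
  ⟨fun hx => ⟨hx.1.of_map hg, hx.2.of_map hg⟩, map_mem_integralUnits g⟩

end IntegralUnits

/-! ### Integral points of tori and their preservation by torus morphisms -/

section TorusIntegralUnits

variable {F E : Type*} [Field F] [Field E] [Algebra F E]
variable {R A : Type*} [CommRing R] [CommRing A] [Algebra F A] (f : R →+* A)

/-- The points of the torus `Res_{K/F} 𝔾ₘ` over `A` which are integral over `R`, and whose
inverses are integral over `R`. -/
def integralPoints (K : IntermediateField F E) : Subgroup (TorusPoints A K) :=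
  integralUnits ((algebraMap A (A ⊗[F] K)).comp f)

/-- A character attached to a coset is an `A`-algebra map, so it commutes with the structure maps
from `R`. -/
theorem map_character_mem_integralUnits (K : IntermediateField F E)
    (c : (E ≃ₐ[F] E) ⧸ K.fixingSubgroup) {x : TorusPoints A K} (hx : x ∈ integralPoints f K) :
    Units.map (character A K c : A ⊗[F] K →* A ⊗[F] E) x ∈
      integralUnits ((algebraMap A (A ⊗[F] E)).comp f) := by
  have h := map_mem_integralUnits (character A K c).toRingHom hx
  rw [← RingHom.comp_assoc] at h
  have hc : (character A K c).toRingHom.comp (algebraMap A (A ⊗[F] K)) =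
      algebraMap A (A ⊗[F] E) := (character A K c).comp_algebraMap
  rwa [hc] at h

/-- The trivial coset gives the base change to `A` of the inclusion of `K` in `E`, which stays
injective by flatness. This single character therefore tests integrality of a point. -/
theorem map_character_one_mem_integralUnits_iff (K : IntermediateField F E)
    {x : TorusPoints A K} :
    Units.map (character A K (QuotientGroup.mk 1) : A ⊗[F] K →* A ⊗[F] E) x ∈
      integralUnits ((algebraMap A (A ⊗[F] E)).comp f) ↔ x ∈ integralPoints f K := by
  have hinj : Function.Injective (character A K (QuotientGroup.mk 1)).toRingHom :=
    character_one_injective A K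
  rw [integralPoints, ← map_mem_integralUnits_iff (B := A ⊗[F] K) (C := A ⊗[F] E) hinj, ← RingHom.comp_assoc]
  have hc : (character A K (QuotientGroup.mk 1)).toRingHom.comp (algebraMap A (A ⊗[F] K)) =
      algebraMap A (A ⊗[F] E) := (character A K (QuotientGroup.mk 1)).comp_algebraMap
  rw [hc]
  rfl

theorem evalChar_mem_integralUnits (K : IntermediateField F E) {x : TorusPoints A K}
    (hx : x ∈ integralPoints f K) (a) :
    evalChar A K x a ∈ integralUnits ((algebraMap A (A ⊗[F] E)).comp f) :=
  Subgroup.prod_mem _ fun c _ => zpow_mem (map_character_mem_integralUnits f K c hx) _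

variable [FiniteDimensional F E] [IsGalois F E] [CharZero F] {K₁ K₂ : IntermediateField F E}

/-- The trivial-coset character pulls back along the morphism to the character `θ(1)` of the source,
which takes integral units as values on integral points. The equivariance of `θ` enters only through
the existence of `torusHom`. -/
theorem torusHom_mem_integralPoints (θ : (PermModule K₂).IntertwiningMap (PermModule K₁))
    {x : TorusPoints A K₁} (hx : x ∈ integralPoints f K₁) :
    torusHom A θ x ∈ integralPoints f K₂ := by
  have h := evalChar_torusHom A θ x (MonoidAlgebra.single (QuotientGroup.mk 1) 1)
  rw [evalChar_single, zpow_one] at h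
  rw [← map_character_one_mem_integralUnits_iff, h]
  exact evalChar_mem_integralUnits f K₁ hx _

theorem torusIso_mem_integralPoints_iff (ψ : (PermModule K₁).Equiv (PermModule K₂))
    {x : TorusPoints A K₁} :
    torusIso A ψ x ∈ integralPoints f K₂ ↔ x ∈ integralPoints f K₁ := by
  refine ⟨fun h => ?_, torusHom_mem_integralPoints f ψ.symm.toIntertwiningMap⟩
  rw [← (torusIso A ψ).symm_apply_apply x]
  exact torusHom_mem_integralPoints f ψ.toIntertwiningMap h

end TorusIntegralUnits

/-! ### Global units as integral points over `ℤ` -/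

section GlobalUnits

theorem mem_globalUnits_iff {K : Type*} [Field K] [NumberField K] {x : Kˣ} :
    x ∈ globalUnits K ↔ x ∈ integralUnits (Int.castRingHom K) := by
  constructor
  · rintro ⟨u, rfl⟩
    exact ⟨u.1.isIntegral_coe, (u⁻¹).1.isIntegral_coe⟩
  · rintro ⟨h1, h2⟩
    refine ⟨⟨⟨x, h1⟩, ⟨_, h2⟩, ?_, ?_⟩, Units.ext rfl⟩
    · exact RingOfIntegers.ext x.mul_inv
    · exact RingOfIntegers.ext x.inv_mul

theorem lid_symm_mem_integralPoints_iff {F E : Type*} [Field F] [NumberField F] [Field E]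
    [NumberField E] [Algebra F E] (K : IntermediateField F E) {x : Kˣ} :
    (Units.mapEquiv (Algebra.TensorProduct.lid F K).toMulEquiv).symm x ∈
      integralPoints (Int.castRingHom F) K ↔ x ∈ globalUnits K := by
  have hinj : Function.Injective (Algebra.TensorProduct.lid F K).symm.toAlgHom.toRingHom :=
    (Algebra.TensorProduct.lid F K).symm.injective
  have h := map_mem_integralUnits_iff (C := F ⊗[F] K) (f := Int.castRingHom K) hinj (x := x)
  -- Both sides are ring maps out of `ℤ`, hence equal.
  have e : (Algebra.TensorProduct.lid F K).symm.toAlgHom.toRingHom.comp (Int.castRingHom K) =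
      (algebraMap F (F ⊗[F] K)).comp (Int.castRingHom F) := RingHom.ext_int _ _
  rw [e] at h
  rw [mem_globalUnits_iff, ← h, integralPoints]
  rfl

end GlobalUnits

/-! ### Local units as integral points over the integers of `F_ω` -/

section LocalUnits

variable {F : Type*} [Field F] [NumberField F]

section
variable {K : Type*} [Field K] [NumberField K] [Algebra F K]

omit [NumberField F] in
theorem mem_localUnits_iff {ω : HeightOneSpectrum (𝓞 F)}
    {x : Π ν : PlacesOver K ω, (ν.1.adicCompletion K)ˣ} :
    x ∈ localUnits K ω ↔ (∀ ν, Valued.v (x ν : ν.1.adicCompletion K) ≤ 1) ∧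
      ∀ ν, Valued.v ((x ν)⁻¹ : (ν.1.adicCompletion K)ˣ).1 ≤ 1 := by
  simp only [localUnits, Subgroup.mem_pi, Set.mem_univ, true_implies, ← forall_and]
  refine forall_congr' fun ν => ?_
  -- `unitGroup` is defined by the valuation attached to the valuation subring, which is only
  -- equivalent to `Valued.v`; the condition of having value `1` transfers.
  have h := Valuation.isEquiv_valuation_valuationSubring
    (Valued.v : Valuation (ν.1.adicCompletion K) _)
  have h1 := h.eq_one_iff_eq_one (x := ((x ν : ν.1.adicCompletion K)))
  refine h1.symm.trans ⟨fun h => ⟨h.le, by simp [h]⟩, fun h => le_antisymm h.1 ?_⟩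
  rw [Units.val_inv_eq_inv_val, map_inv₀] at h
  exact (inv_le_one₀ (by simp [zero_lt_iff])).1 h.2

/-- The structure map from the integers of `F_ω` to `F_ω ⊗ K`. -/
abbrev integersToTensor (K : Type*) [Field K] [Algebra F K] (ω : HeightOneSpectrum (𝓞 F)) :
    ω.adicCompletionIntegers F →+* ω.adicCompletion F ⊗[F] K :=
  (algebraMap (ω.adicCompletion F) (ω.adicCompletion F ⊗[F] K)).comp
    (ω.adicCompletionIntegers F).subtype

/-- The projection to `K_ν` sends the integers of `F_ω` into those of `K_ν`, and the latter, a
valuation ring, is integrally closed. -/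
theorem valued_le_one_of_isIntegralElem {ω : HeightOneSpectrum (𝓞 F)}
    {x : ω.adicCompletion F ⊗[F] K} (hx : (integersToTensor K ω).IsIntegralElem x)
    (ν : PlacesOver K ω) : Valued.v (completionTensorMap K ω x ν) ≤ 1 := by
  let g : ω.adicCompletionIntegers F →+* ν.1.adicCompletionIntegers K :=
    ((adicCompletionMap ω ν).comp (ω.adicCompletionIntegers F).subtype).codRestrict
      (ν.1.adicCompletionIntegers K).toSubring
      fun r => adicCompletionMap_integers ω ν r r.2
  let e : (ω.adicCompletion F ⊗[F] K) →+* ν.1.adicCompletion K :=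
    (Pi.evalRingHom _ ν).comp (completionTensorMap K ω).toRingHom
  have h1 := hx.map e
  have h2 : e.comp (integersToTensor K ω) = (ν.1.adicCompletionIntegers K).subtype.comp g := by
    refine RingHom.ext fun r => ?_
    change adicCompletionMap ω ν r * algebraMap K _ 1 = adicCompletionMap ω ν r
    rw [map_one, mul_one]
  -- Factoring the structure map through the integers of `K_ν` turns integrality over the integers
  -- of `F_ω` into integrality over those of `K_ν`.
  rw [h2] at h1
  obtain ⟨y, hy⟩ := (IsIntegrallyClosed.isIntegral_iff (R := ν.1.adicCompletionIntegers K)).1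
    h1.of_comp
  have : (y : ν.1.adicCompletion K) = completionTensorMap K ω x ν := hy
  rw [← this]
  exact y.2

omit [NumberField K] in
theorem isIntegralElem_one_tmul (ω : HeightOneSpectrum (𝓞 F)) (z : 𝓞 K) :
    (integersToTensor K ω).IsIntegralElem (1 ⊗ₜ algebraMap (𝓞 K) K z) := by
  have h := RingHom.IsIntegralElem.map (f := Int.castRingHom K) (x := algebraMap (𝓞 K) K z)
    z.isIntegral_coe
    (Algebra.TensorProduct.includeRight : K →ₐ[F] ω.adicCompletion F ⊗[F] K).toRingHom
  rw [RingHom.ext_int (RingHom.comp _ _)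
    ((integersToTensor K ω).comp (Int.castRingHom _))] at h
  exact h.of_comp

omit [NumberField K] in
theorem isIntegralElem_tmul_one {ω : HeightOneSpectrum (𝓞 F)} {c : ω.adicCompletion F}
    (hc : Valued.v c ≤ 1) : (integersToTensor K ω).IsIntegralElem (c ⊗ₜ 1) :=
  (integersToTensor K ω).isIntegralElem_map (x := ⟨c, hc⟩)

/-- Only the places above `ω` are controlled. The poles of `y` elsewhere are cleared by some `s ∈ 𝓞
F` outside `ω`, and dividing by `s` again is harmless because `s` is a unit at `ω`. -/
theorem isIntegralElem_one_tmul_of_valuation_le_one {ω : HeightOneSpectrum (𝓞 F)} {y : K}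
    (hy : ∀ ν : PlacesOver K ω, ν.1.valuation K y ≤ 1) :
    (integersToTensor K ω).IsIntegralElem (1 ⊗ₜ y) := by
  obtain ⟨s, hs, z, hz⟩ := exists_mul_mem_integers ω y hy
  have hv := ω.valuation_eq_one_iff_notMem (K := F).2 hs
  have hs0 : algebraMap (𝓞 F) F s ≠ 0 := fun h => by simp [h] at hv
  have h1 : Valued.v (algebraMap F (ω.adicCompletion F) (algebraMap (𝓞 F) F s)⁻¹) ≤ 1 := by
    rw [valued_algebraMap, map_inv₀, hv, inv_one]
  -- Here `z = s y`; the scalar `s⁻¹` is moved across the tensor sign into the integers of `F_ω`.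
  have h2 : (1 : ω.adicCompletion F) ⊗ₜ[F] y =
      (algebraMap F (ω.adicCompletion F) (algebraMap (𝓞 F) F s)⁻¹) ⊗ₜ 1 *
        1 ⊗ₜ algebraMap (𝓞 K) K z := by
    rw [Algebra.TensorProduct.tmul_mul_tmul, one_mul, mul_one, Algebra.algebraMap_eq_smul_one,
      TensorProduct.smul_tmul, hz, IsScalarTower.algebraMap_apply (𝓞 F) F K, Algebra.smul_def,
      ← mul_assoc, ← map_mul, inv_mul_cancel₀ hs0, map_one, one_mul]
  rw [h2]
  exact (isIntegralElem_tmul_one h1).mul _ (isIntegralElem_one_tmul ω z)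

theorem isIntegralElem_sum {R B ι : Type*} [CommRing R] [CommRing B] (f : R →+* B)
    (s : Finset ι) (x : ι → B) (h : ∀ i ∈ s, f.IsIntegralElem (x i)) :
    f.IsIntegralElem (∑ i ∈ s, x i) :=
  letI := f.toAlgebra
  IsIntegral.sum x h

/-- The chosen basis `b` need not generate the integral closure, so the coordinates of `x` may fail
to be integral. They are approximated by elements of `F` up to integral errors, and the global
remainder is handled by its valuations alone. -/
theorem isIntegralElem_of_valued_le_one {ω : HeightOneSpectrum (𝓞 F)}
    {x : ω.adicCompletion F ⊗[F] K}
    (hx : ∀ ν, Valued.v (completionTensorMap K ω x ν) ≤ 1) :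
    (integersToTensor K ω).IsIntegralElem x := by
  classical
  obtain ⟨s, b, hb'⟩ := FiniteDimensional.exists_is_basis_integral (𝓞 F) F K
  have hb : ∀ i, IsIntegral ℤ (b i) := fun i => isIntegral_trans (b i) (hb' i)
  let B := Algebra.TensorProduct.basis (ω.adicCompletion F) b
  have happrox : ∀ j, ∃ α : F,
      Valued.v (B.repr x j - algebraMap F (ω.adicCompletion F) α) ≤ 1 := by
    intro j
    have h1 : IsOpen {c : ω.adicCompletion F | Valued.v c ≤ 1} :=
      Valued.isOpen_integer (ω.adicCompletion F)
    have h2 : IsOpen {c : ω.adicCompletion F | Valued.v (B.repr x j - c) ≤ 1} :=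
      h1.preimage (continuous_const.sub continuous_id)
    -- The closed unit ball around the coordinate is open and nonempty, so it meets the dense image
    -- of `F`.
    obtain ⟨_, h3, α, rfl⟩ := (ω.denseRange_algebraMap F).inter_open_nonempty _ h2
      ⟨B.repr x j, by simp⟩
    exact ⟨α, h3⟩
  choose α hα using happrox
  set d := ∑ j, (B.repr x j - algebraMap F (ω.adicCompletion F) (α j)) ⊗ₜ[F] b j with hd
  have hdint : (integersToTensor K ω).IsIntegralElem d := by
    refine isIntegralElem_sum _ _ _ fun j _ => ?_
    have h := (isIntegralElem_tmul_one (K := K) (hα j)).mul _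
      (isIntegralElem_one_tmul ω (⟨b j, hb j⟩ : 𝓞 K))
    rwa [Algebra.TensorProduct.tmul_mul_tmul, mul_one, one_mul] at h
  have hxd : x = d + 1 ⊗ₜ ∑ j, α j • b j := by
    conv_lhs => rw [← B.sum_repr x]
    rw [hd, TensorProduct.tmul_sum, ← Finset.sum_add_distrib]
    refine Finset.sum_congr rfl fun j _ => ?_
    rw [Algebra.TensorProduct.basis_apply, TensorProduct.smul_tmul', smul_eq_mul, mul_one,
      ← TensorProduct.smul_tmul, ← TensorProduct.add_tmul, ← Algebra.algebraMap_eq_smul_one,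
      sub_add_cancel]
  rw [hxd]
  refine hdint.add _ (isIntegralElem_one_tmul_of_valuation_le_one fun ν => ?_)
  -- At `ν` the global remainder is the difference of the components of `x` and `d`: the first is
  -- integral by hypothesis, the second because `d` is integral over the integers of `F_ω`.
  have h1 : algebraMap K (ν.1.adicCompletion K) (∑ j, α j • b j) =
      completionTensorMap K ω x ν - completionTensorMap K ω d ν := by
    rw [hxd, map_add, Pi.add_apply, add_sub_cancel_left, completionTensorMap_tmul, map_one,
      one_mul]
  rw [← valued_algebraMap, h1]
  exact Valuation.map_sub_le _ (hx ν) (valued_le_one_of_isIntegralElem hdint ν)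

theorem isIntegralElem_iff_valued_le_one {ω : HeightOneSpectrum (𝓞 F)}
    {x : ω.adicCompletion F ⊗[F] K} :
    (integersToTensor K ω).IsIntegralElem x ↔
      ∀ ν, Valued.v (completionTensorMap K ω x ν) ≤ 1 :=
  ⟨valued_le_one_of_isIntegralElem, isIntegralElem_of_valued_le_one⟩

end

theorem localPoints_mem_localUnits_iff {E : Type*} [Field E] [NumberField E] [Algebra F E]
    (K : IntermediateField F E) {ω : HeightOneSpectrum (𝓞 F)}
    {x : TorusPoints (ω.adicCompletion F) K} :
    localPoints K ω x ∈ localUnits K ω ↔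
      x ∈ integralPoints (ω.adicCompletionIntegers F).subtype K := by
  rw [mem_localUnits_iff, integralPoints, mem_integralUnits, isIntegralElem_iff_valued_le_one,
    isIntegralElem_iff_valued_le_one]
  rfl

end LocalUnits

end

end TorusIso

theorem mainTheorem9 {F E : Type*} [Field F] [NumberField F] [Field E] [NumberField E]
    [Algebra F E] [IsGalois F E] (K₁ K₂ : IntermediateField F E)
    (ψ : (TorusIso.PermModule K₁).Equiv (TorusIso.PermModule K₂)) :
    (∀ ω : IsDedekindDomain.HeightOneSpectrum (NumberField.RingOfIntegers F),
      (TorusIso.localUnits K₁ ω).map (TorusIso.localIso ψ ω).toMonoidHom =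
        TorusIso.localUnits K₂ ω) ∧
    (TorusIso.globalUnits K₁).map (TorusIso.globalIso ψ).toMonoidHom =
      TorusIso.globalUnits K₂ := by
  -- An isomorphism carries `S` onto `T` once membership corresponds in both directions.
  have key : ∀ {G H : Type _} [Group G] [Group H] (e : G ≃* H) (S : Subgroup G) (T : Subgroup H),
      (∀ x, e x ∈ T ↔ x ∈ S) → S.map e.toMonoidHom = T := by
    intro G H _ _ e S T h
    ext y
    rw [Subgroup.mem_map_equiv, ← h, e.apply_symm_apply]
  refine ⟨fun ω => key _ _ _ fun x => ?_, ?_⟩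
  -- In tensor coordinates the local isomorphism becomes `torusIso`, to which the integrality
  -- criterion applies.
  · obtain ⟨x, rfl⟩ := (TorusIso.localPoints K₁ ω).surjective x
    have h : TorusIso.localIso ψ ω (TorusIso.localPoints K₁ ω x) =
        TorusIso.localPoints K₂ ω (TorusIso.torusIso _ ψ x) := by
      simp [TorusIso.localIso]
    rw [h, TorusIso.localPoints_mem_localUnits_iff, TorusIso.localPoints_mem_localUnits_iff,
      TorusIso.torusIso_mem_integralPoints_iff]
  · ext y
    obtain ⟨x, rfl⟩ := (TorusIso.globalIso ψ).surjective y
    have h : (Units.mapEquiv (Algebra.TensorProduct.lid F K₂).toMulEquiv).symm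
        (TorusIso.globalIso ψ x) = TorusIso.torusIso F ψ
          ((Units.mapEquiv (Algebra.TensorProduct.lid F K₁).toMulEquiv).symm x) := by
      simp only [TorusIso.globalIso, MulEquiv.trans_apply, MulEquiv.symm_apply_apply]
    rw [Subgroup.mem_map_equiv, MulEquiv.symm_apply_apply,
      ← TorusIso.lid_symm_mem_integralPoints_iff, ← TorusIso.lid_symm_mem_integralPoints_iff, h,
      TorusIso.torusIso_mem_integralPoints_iff]
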